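/- Let $X$ and $Y$ be complex Banach spaces, and let $A\in B(X)$, $B\in B(Y)$ be bounded linear operators. For $C\in B(Y,X)$ (the bounded linear operators $Y\to X$) let $M_C\in B(X\oplus Y)$ be the operator $M_C(x,y)=(Ax+Cy,\,By)$. For a bounded operator $T$ on a complex Banach space $Z$, let $N(T)$ and $R(T)$ be its kernel and range, and let its ascent $\mathrm{asc}(T)$ and descent $\mathrm{des}(T)$ be the least integers $k\ge 0$ with $N(T^k)=N(T^{k+1})$, respectively $R(T^k)=R(T^{k+1})$ ($\infty$ if there is none). The operator $T$ is - *Browder* if $\dim N(T)<\infty$, $\dim Z/R(T)<\infty$ and $\mathrm{asc}(T)=\mathrm{des}(T)<\infty$; - *left semi-Browder* if $R(T)$ is closed and complemented in $Z$, $\dim N(T)<\infty$ and $\mathrm{asc}(T)<\infty$; - *right semi-Browder* if $N(T)$ is (closed and) complemented in $Z$, $\dim Z/R(T)<\infty$ and $\mathrm{des}(T)<\infty$. Let $\sigma_b(T)$, $\sigma_{lb}(T)$, $\sigma_{rb}(T)$ be the sets of $\lambda\in\mathbb C$ for which $T-\lambda I$ is not Browder, not left semi-Browder, not right semi-Browder,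 respectively. Then $$\bigcap_{C\in B(Y,X)}\sigma_b(M_C)=\sigma_{lb}(A)\cup\sigma_{rb}(B)\cup\{\lambda\in\mathbb C:\ N(A-\lambda)\times N(B-\lambda)\not\cong X/R(A-\lambda)\times Y/R(B-\lambda)\},$$ where $\cong$ means that there is a linear homeomorphism (quotients carrying the quotient topology). -/

import Mathlib

/-- The kernel `N(T)` of a bounded operator. -/
abbrev opKer {X : Type*} [NormedAddCommGroup X] [NormedSpace ℂ X] (T : X →L[ℂ] X) :
    Submodule ℂ X :=
  LinearMap.ker (T : X →ₗ[ℂ] X)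

/-- The range `R(T)` of a bounded operator. -/
abbrev opRange {X : Type*} [NormedAddCommGroup X] [NormedSpace ℂ X] (T : X →L[ℂ] X) :
    Submodule ℂ X :=
  LinearMap.range (T : X →ₗ[ℂ] X)

/-- The ascent: the least `k` with `N(T^k) = N(T^(k+1))`, and `⊤` if there is none. -/
noncomputable def ascent {X : Type*} [NormedAddCommGroup X] [NormedSpace ℂ X]
    (T : X →L[ℂ] X) : ℕ∞ :=
  ⨅ k ∈ {k : ℕ | opKer (T ^ k) = opKer (T ^ (k + 1))}, (k : ℕ∞)

/-- The descent: the least `k` with `R(T^k) = R(T^(k+1))`, and `⊤` if there is none. -/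
noncomputable def descent {X : Type*} [NormedAddCommGroup X] [NormedSpace ℂ X]
    (T : X →L[ℂ] X) : ℕ∞ :=
  ⨅ k ∈ {k : ℕ | opRange (T ^ k) = opRange (T ^ (k + 1))}, (k : ℕ∞)

/-- On a Banach space, Mathlib's Fredholm operators are exactly the bounded operators with
finite-dimensional kernel and finite-codimensional range. -/
theorem isFredholm_iff_finite {X : Type*} [NormedAddCommGroup X] [NormedSpace ℂ X]
    [CompleteSpace X] (T : X →L[ℂ] X) :
    T.IsFredholm ↔
      FiniteDimensional ℂ (opKer T) ∧ FiniteDimensional ℂ (X ⧸ opRange T) := by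
  refine ⟨fun h => ⟨h.finite_ker, h.finite_coker⟩, ?_⟩
  rintro ⟨hk, hc⟩
  have hkc : (opKer T).ClosedComplemented :=
    Submodule.ClosedComplemented.of_finiteDimensional _
  have hcl : IsClosed (opRange T : Set X) := by
    obtain ⟨q, hq, hcompl⟩ := hkc.exists_isClosed_isCompl
    obtain ⟨G, hG⟩ := (opRange T).exists_isCompl
    have : FiniteDimensional ℂ G :=
      LinearEquiv.finiteDimensional (Submodule.quotientEquivOfIsCompl _ _ hG)
    have hqc : CompleteSpace q := hq.completeSpace_coe
    have hr : opRange T = (T.comp q.subtypeL).range := by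
      apply le_antisymm
      · rintro _ ⟨x, rfl⟩
        obtain ⟨u, hu, v, hv, rfl⟩ :=
          Submodule.mem_sup.1 (hcompl.sup_eq_top ▸ Submodule.mem_top (x := x))
        have hu0 : T u = 0 := hu
        exact ⟨⟨v, hv⟩, by simp [hu0]⟩
      · rintro _ ⟨x, rfl⟩
        exact ⟨x, rfl⟩
    rw [hr] at hG ⊢
    refine ContinuousLinearMap.closed_complemented_range_of_isCompl_of_ker_eq_bot
      (T.comp q.subtypeL) G hG G.closed_of_finiteDimensional ?_
    rw [LinearMap.ker_eq_bot']
    intro x hx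
    exact Subtype.ext (Submodule.disjoint_def.1 hcompl.disjoint x hx x.2)
  refine ⟨?_, hcl, hk, hc, hkc⟩
  have hrc : CompleteSpace (opRange T) := hcl.completeSpace_coe
  exact ((T.rangeRestrict).isOpenMap
    (LinearMap.surjective_rangeRestrict (T : X →ₗ[ℂ] X))).isQuotientMap
    T.rangeRestrict.continuous (LinearMap.surjective_rangeRestrict (T : X →ₗ[ℂ] X))

/-- Left semi-Fredholm operators: the range is closed and complemented, and the kernel is
finite-dimensional. -/
def IsLeftSemiFredholm {X : Type*} [NormedAddCommGroup X] [NormedSpace ℂ X]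
    (T : X →L[ℂ] X) : Prop :=
  IsClosed (opRange T : Set X) ∧ (opRange T).ClosedComplemented ∧
    FiniteDimensional ℂ (opKer T)

/-- Right semi-Fredholm operators: the kernel is closed and complemented, and the range is
finite-codimensional. -/
def IsRightSemiFredholm {X : Type*} [NormedAddCommGroup X] [NormedSpace ℂ X]
    (T : X →L[ℂ] X) : Prop :=
  IsClosed (opKer T : Set X) ∧ (opKer T).ClosedComplemented ∧
    FiniteDimensional ℂ (X ⧸ opRange T)

/-- Browder operators: Fredholm with equal finite ascent and descent. -/
def IsBrowder {X : Type*} [NormedAddCommGroup X] [NormedSpace ℂ X]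
    (T : X →L[ℂ] X) : Prop :=
  T.IsFredholm ∧ ascent T = descent T ∧ ascent T < ⊤

/-- Left semi-Browder operators: left semi-Fredholm with finite ascent. -/
def IsLeftSemiBrowder {X : Type*} [NormedAddCommGroup X] [NormedSpace ℂ X]
    (T : X →L[ℂ] X) : Prop :=
  IsLeftSemiFredholm T ∧ ascent T < ⊤

/-- Right semi-Browder operators: right semi-Fredholm with finite descent. -/
def IsRightSemiBrowder {X : Type*} [NormedAddCommGroup X] [NormedSpace ℂ X]
    (T : X →L[ℂ] X) : Prop :=
  IsRightSemiFredholm T ∧ descent T < ⊤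

/-- The operator `T - λ`. -/
abbrev opShift {X : Type*} [NormedAddCommGroup X] [NormedSpace ℂ X]
    (T : X →L[ℂ] X) (z : ℂ) : X →L[ℂ] X :=
  T - z • (1 : X →L[ℂ] X)

/-- The Browder spectrum. -/
def browderSpectrum {X : Type*} [NormedAddCommGroup X] [NormedSpace ℂ X]
    (T : X →L[ℂ] X) : Set ℂ :=
  {z | ¬ IsBrowder (opShift T z)}

/-- The left semi-Browder spectrum. -/
def leftBrowderSpectrum {X : Type*} [NormedAddCommGroup X] [NormedSpace ℂ X]
    (T : X →L[ℂ] X) : Set ℂ :=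
  {z | ¬ IsLeftSemiBrowder (opShift T z)}

/-- The right semi-Browder spectrum. -/
def rightBrowderSpectrum {X : Type*} [NormedAddCommGroup X] [NormedSpace ℂ X]
    (T : X →L[ℂ] X) : Set ℂ :=
  {z | ¬ IsRightSemiBrowder (opShift T z)}

/-- The upper-triangular operator matrix `M_C (x, y) = (A x + C y, B y)` on `X × Y`. -/
def upperTriangular {X Y : Type*} [NormedAddCommGroup X] [NormedSpace ℂ X]
    [NormedAddCommGroup Y] [NormedSpace ℂ Y]
    (A : X →L[ℂ] X) (B : Y →L[ℂ] Y) (C : Y →L[ℂ] X) : (X × Y) →L[ℂ] (X × Y) :=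
  (A.coprod C).prod (B.comp (ContinuousLinearMap.snd ℂ X Y))

/-!
After translation by the spectral parameter, the claim is that some `M_C` is Browder if and only if
`A` is left semi-Browder, `B` is right semi-Browder and `N(A) × N(B) ≃ X/R(A) × Y/R(B)`.

*If `M_C` is Browder*, the diagonal corners of an inverse of `M_C` modulo finite-rank operators
invert `A` on the left and `B` on the right modulo finite rank, and the ascent of `A` and the descent
of `B` are bounded by those of `M_C`. Because the kernels and ranges of the powers of `M_C`
stabilise, additivity of the index forces `M_C` to have index zero
(`LinearMap.HasIndex.eq_zero_of_pow`). By the snake lemma (`LinearMap.HasIndex.connecting`) the map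
`N(A) × N(B) → X/R(A) × Y/R(B)`, `(a, b) ↦ ([C b], 0)`, then has index zero as well, and an operator
of index zero between Banach spaces is a finite-rank perturbation of an isomorphism.

*Conversely*, a left semi-Browder operator `A` commutes with a finite-rank idempotent `P` such that
`A P` is nilpotent and `A + P` is left invertible, and a right semi-Browder operator `B` has an
analogous `Q` with `B + Q` right invertible. This is pure ring theory modulo the ideal of
finite-rank operators, all of which are von Neumann regular
(`exists_idempotent_nilpotent_leftInverse`); the right-handed case is the left-handed one in the
opposite ring. An index count cancels the finite-dimensional summands in the given isomorphism and
yields `N(B + Q) ≃ X/R(A + P)` (`nonempty_ker_equiv_ker`). Taking `C` to be this isomorphism into a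
complement of `R(A + P)`, extended by zero, makes `M_C + diag(P, Q)` invertible, while `diag(P, Q)`
commutes with `M_C` and `M_C diag(P, Q)` is nilpotent; such an operator is Browder
(`isBrowder_of_idempotent`).
-/

/-! ### Idempotents from stabilising annihilators in rings -/

/-- If `a - a s a` is von Neumann regular, then so is `a`. -/
theorem exists_mul_mul_eq_self_of_sub {R : Type*} [Ring R] {a s z : R}
    (hz : (a - a * s * a) * z * (a - a * s * a) = a - a * s * a) : ∃ y, a * y * a = a := by
  refine ⟨s + (1 - s * a) * z * (1 - a * s), ?_⟩
  calc a * (s + (1 - s * a) * z * (1 - a * s)) * a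
      = a * s * a + (a - a * s * a) * z * (a - a * s * a) := by noncomm_ring
    _ = a := by rw [hz]; abel

/-- If `a` is left invertible modulo a two-sided ideal of von Neumann regular elements, then `a` is
itself von Neumann regular. -/
theorem exists_mul_mul_eq_self_of_one_sub_mul_mem {R : Type*} [Ring R] {I : TwoSidedIdeal R}
    (hI : ∀ x ∈ I, ∃ y, x * y * x = x) {a s : R} (hs : 1 - s * a ∈ I) :
    ∃ y, a * y * a = a := by
  have h : a - a * s * a ∈ I := by
    simpa only [mul_sub, mul_one, mul_assoc] using I.mul_mem_left a _ hs
  obtain ⟨z, hz⟩ := hI _ h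
  exact exists_mul_mul_eq_self_of_sub hz

/-- The right-handed counterpart of `exists_mul_mul_eq_self_of_one_sub_mul_mem`. -/
theorem exists_mul_mul_eq_self_of_one_sub_mul_mem_right {R : Type*} [Ring R] {I : TwoSidedIdeal R}
    (hI : ∀ x ∈ I, ∃ y, x * y * x = x) {a s : R} (hs : 1 - a * s ∈ I) :
    ∃ y, a * y * a = a := by
  have h : a - a * s * a ∈ I := by
    simpa only [sub_mul, one_mul] using I.mul_mem_right _ a hs
  obtain ⟨z, hz⟩ := hI _ h
  exact exists_mul_mul_eq_self_of_sub hz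

theorem one_sub_pow_mul_pow_mem {R : Type*} [Ring R] {I : TwoSidedIdeal R} {a s : R}
    (hs : 1 - s * a ∈ I) (k : ℕ) : 1 - s ^ k * a ^ k ∈ I := by
  induction k with
  | zero => simp
  | succ k ih =>
    have h : 1 - s ^ (k + 1) * a ^ (k + 1) =
        (1 - s ^ k * a ^ k) + s ^ k * (1 - s * a) * a ^ k := by
      rw [pow_succ, pow_succ']; noncomm_ring
    rw [h]
    exact I.add_mem ih (I.mul_mem_right _ _ (I.mul_mem_left _ _ hs))

/-- The Sylvester-type equation `q = (a q - d) l` is solved by a finite geometric sum as soon as a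
power of `a` annihilates `d`. -/
theorem exists_eq_mul_sub_mul {R : Type*} [Ring R] {a e d l : R} {m : ℕ} (hm : a ^ m * e = 0)
    (he : ∀ k, e * (a ^ k * e) = a ^ k * e) (hd : e * d = d) :
    ∃ q, q = (a * q - d) * l ∧ e * q = q := by
  refine ⟨-∑ k ∈ Finset.range m, a ^ k * d * l ^ (k + 1), ?_, ?_⟩
  · have h0 : a ^ m * d * l ^ (m + 1) = 0 := by rw [← hd, ← mul_assoc, hm, zero_mul, zero_mul]
    have h1 : a * (∑ k ∈ Finset.range m, a ^ k * d * l ^ (k + 1)) * l =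
        ∑ k ∈ Finset.range m, a ^ (k + 1) * d * l ^ (k + 1 + 1) := by
      rw [Finset.mul_sum, Finset.sum_mul]
      refine Finset.sum_congr rfl fun k _ => ?_
      rw [pow_succ' a, pow_succ l (k + 1)]
      simp only [mul_assoc]
    have h2 := Finset.sum_range_succ (fun k => a ^ k * d * l ^ (k + 1)) m
    rw [Finset.sum_range_succ', h0, ← h1] at h2
    simp only [pow_zero, one_mul, zero_add, pow_one, add_zero] at h2
    rw [mul_neg, sub_mul, neg_mul]
    nth_rewrite 1 [← h2]
    abel
  · rw [mul_neg, Finset.mul_sum]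
    congr 1
    refine Finset.sum_congr rfl fun k _ => ?_
    rw [← mul_assoc, ← mul_assoc]
    congr 1
    calc e * a ^ k * d = e * (a ^ k * e) * d := by simp only [mul_assoc, hd]
      _ = a ^ k * d := by rw [he, mul_assoc, hd]

/-- The ring-theoretic core of the Kato decomposition of a left semi-Browder operator: an element
`a` that is left invertible modulo an ideal `I` of regular elements, and whose powers have
stabilising right annihilators, splits along an idempotent `P ∈ I` commuting with `a` into a
nilpotent part `a P` and a left invertible part. The latter is recorded as a left inverse `l` of
`a + P`, which commutes with `P` and is two-sided on the corner of `P`. -/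
theorem exists_idempotent_nilpotent_leftInverse {R : Type*} [Ring R] {I : TwoSidedIdeal R}
    (hI : ∀ x ∈ I, ∃ y, x * y * x = x) {a s : R} (hs : 1 - s * a ∈ I) {p : ℕ}
    (hp : ∀ x, a ^ (p + 1) * x = 0 → a ^ p * x = 0) :
    ∃ P ∈ I, P * P = P ∧ a * P = P * a ∧ (∃ n, a ^ n * P = 0) ∧
      ∃ l, l * (a + P) = 1 ∧ l * P = P * l ∧ (1 - (a + P) * l) * P = 0 := by
  obtain ⟨z, hz⟩ := exists_mul_mul_eq_self_of_one_sub_mul_mem hI (one_sub_pow_mul_pow_mem hs p)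
  -- `e` projects onto the kernel of `a ^ p`, and `f` is the complementary idempotent.
  obtain ⟨f, hf⟩ : ∃ f, f = z * a ^ p := ⟨_, rfl⟩
  obtain ⟨e, he⟩ : ∃ e, e = 1 - f := ⟨_, rfl⟩
  have hef : e + f = 1 := by rw [he]; abel
  have hae : a ^ p * e = 0 := by rw [he, hf, mul_sub, mul_one, ← mul_assoc, hz, sub_self]
  have hfe : f * e = 0 := by rw [hf, mul_assoc, hae, mul_zero]
  have hff : f * f = f := by
    have : f * (e + f) = f := by rw [hef, mul_one]
    rwa [mul_add, hfe, zero_add] at this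
  have hee : e * e = e := by
    have : (e + f) * e = e := by rw [hef, one_mul]
    rwa [add_mul, hfe, add_zero] at this
  have heI : e ∈ I := by
    have h : e = (1 - s ^ p * a ^ p) * e := by
      rw [sub_mul, mul_assoc, hae, mul_zero, one_mul, sub_zero]
    rw [h]
    exact I.mul_mem_right _ _ (one_sub_pow_mul_pow_mem hs p)
  have heae : ∀ k, e * (a ^ k * e) = a ^ k * e := by
    intro k
    have h : f * (a ^ k * e) = 0 := by
      rw [hf, mul_assoc, ← mul_assoc (a ^ p), ← pow_add, add_comm, pow_add, mul_assoc, hae,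
        mul_zero, mul_zero]
    have := congrArg (· * (a ^ k * e)) hef
    simpa only [add_mul, h, add_zero, one_mul] using this
  -- `f a` is regular, which makes the compression of `a` to the corner of `f` left invertible.
  have hsf : 1 - s * (f * a) ∈ I := by
    have h : 1 - s * (f * a) = (1 - s * a) + s * e * a := by rw [he]; noncomm_ring
    rw [h]
    exact I.add_mem hs (I.mul_mem_right _ _ (I.mul_mem_left _ _ heI))
  obtain ⟨y, hy⟩ := exists_mul_mul_eq_self_of_one_sub_mul_mem hI hsf
  have hfy : f * (y * (f * a)) = f := by
    have h1 : f * a * (1 - y * (f * a)) = 0 := by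
      rw [mul_sub, mul_one, ← mul_assoc, hy, sub_self]
    have h2 : a ^ (p + 1) * (1 - y * (f * a)) = 0 := by
      calc a ^ (p + 1) * (1 - y * (f * a))
          = a ^ p * z * a ^ p * a * (1 - y * (f * a)) := by rw [hz, pow_succ]
        _ = a ^ p * (f * a * (1 - y * (f * a))) := by rw [hf]; simp only [mul_assoc]
        _ = 0 := by rw [h1, mul_zero]
    have h3 : f * (1 - y * (f * a)) = 0 := by
      nth_rewrite 1 [hf]
      rw [mul_assoc, hp _ h2, mul_zero]
    rw [mul_sub, mul_one] at h3
    exact (sub_eq_zero.mp h3).symm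
  obtain ⟨L, hL⟩ : ∃ L, L = f * y * f := ⟨_, rfl⟩
  have hLa : L * a = f := by rw [hL]; simpa only [mul_assoc] using hfy
  have hLf : L * f = L := by rw [hL, mul_assoc, hff]
  have hLe : L * e = 0 := by rw [← hLf, mul_assoc, hfe, mul_zero]
  obtain ⟨q, hq, heq⟩ := exists_eq_mul_sub_mul (l := L) hae heae
    (show e * (e * a * f) = e * a * f by rw [← mul_assoc, ← mul_assoc, hee])
  have hqf : q * f = q := by rw [hq, mul_assoc, hLf]
  have hqe : q * e = 0 := by rw [← hqf, mul_assoc, hfe, mul_zero]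
  have hqa : q * a = a * q - e * a * f := by
    have h : q * a = (a * q - e * a * f) * (L * a) := by rw [← mul_assoc, ← hq]
    rw [h, hLa, sub_mul, mul_assoc a, hqf, mul_assoc _ f f, hff]
  obtain ⟨P, hP⟩ : ∃ P, P = e + q := ⟨_, rfl⟩
  have heP : e * P = P := by rw [hP, mul_add, hee, heq]
  have hPe : P * e = e := by rw [hP, add_mul, hee, hqe, add_zero]
  have hPP : P * P = P := by
    calc P * P = P * e * P := by rw [mul_assoc, heP]
      _ = P := by rw [hPe, heP]
  have haP : a * P = P * a := by
    have h1 : e * a = e * a * e + e * a * f := by rw [← mul_add, hef, mul_one]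
    have h2 : e * a * e = a * e := by simpa only [pow_one, mul_assoc] using heae 1
    rw [h2] at h1
    rw [hP, mul_add, add_mul, hqa, eq_sub_of_add_eq' h1.symm]
    abel
  have hn : a ^ p * P = 0 := by rw [← heP, ← mul_assoc, hae, zero_mul]
  have hnil : IsNilpotent (a * P) := by
    refine ⟨p + 1, ?_⟩
    rw [(show Commute a P from haP).mul_pow, pow_succ' a, pow_succ' P, ← mul_assoc, mul_assoc a,
      hn, mul_zero, zero_mul]
  obtain ⟨u, hu⟩ := hnil.isUnit_one_add
  have huP : (u : R) * P = P + a * P := by rw [hu, add_mul, one_mul, mul_assoc, hPP]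
  have hcomm : Commute (u : R) P := by
    rw [hu]
    refine (Commute.one_left P).add_left ?_
    rw [Commute, SemiconjBy, mul_assoc, hPP, haP, ← mul_assoc, hPP]
  have hwP : (↑u⁻¹ : R) * P = P * ↑u⁻¹ := hcomm.units_inv_left
  have hLP : L * P = 0 := by rw [← heP, ← mul_assoc, hLe, zero_mul]
  refine ⟨P, ?_, hPP, haP, ⟨p, hn⟩, ↑u⁻¹ * P + (1 - P) * L, ?_, ?_, ?_⟩
  · rw [← heP]
    exact I.mul_mem_right _ _ heI
  · have h1 : (1 - P) * f = 1 - P := by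
      have h : (1 - P) * (e + f) = 1 - P := by rw [hef, mul_one]
      rwa [mul_add, sub_mul 1 P e, one_mul, hPe, sub_self, zero_add] at h
    calc (↑u⁻¹ * P + (1 - P) * L) * (a + P)
        = ↑u⁻¹ * (P * P + P * a) + (1 - P) * (L * a) + (1 - P) * (L * P) := by noncomm_ring
      _ = 1 := by
        rw [hPP, ← haP, ← huP, hLa, hLP, h1, Units.inv_mul_cancel_left, mul_zero]; abel
  · rw [add_mul, mul_add, mul_assoc, hPP, mul_assoc, hLP, mul_zero, add_zero, ← mul_assoc P (1 - P),
      mul_sub, mul_one, hPP, sub_self, zero_mul, add_zero, hwP, ← mul_assoc, hPP]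
  · have h : (a + P) * (↑u⁻¹ * P) = P := by
      rw [hwP, ← mul_assoc, add_mul, hPP, add_comm, ← huP, hcomm.eq, Units.mul_inv_cancel_right]
    rw [sub_mul, one_mul, mul_assoc, add_mul _ _ P, mul_assoc _ P P, hPP, mul_assoc _ L, hLP,
      mul_zero, add_zero, h, sub_self]

/-- The right-handed counterpart of `exists_idempotent_nilpotent_leftInverse`. -/
theorem exists_idempotent_nilpotent_rightInverse {R : Type*} [Ring R] {I : TwoSidedIdeal R}
    (hI : ∀ x ∈ I, ∃ y, x * y * x = x) {b s : R} (hs : 1 - b * s ∈ I) {p : ℕ}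
    (hp : ∀ x, x * b ^ (p + 1) = 0 → x * b ^ p = 0) :
    ∃ Q ∈ I, Q * Q = Q ∧ b * Q = Q * b ∧ (∃ n, b ^ n * Q = 0) ∧
      ∃ r, (b + Q) * r = 1 ∧ r * Q = Q * r ∧ Q * (1 - r * (b + Q)) = 0 := by
  obtain ⟨P, hPI, hPP, haP, ⟨n, hn⟩, l, hl, hlP, hlP'⟩ :=
    exists_idempotent_nilpotent_leftInverse (R := Rᵐᵒᵖ) (I := I.op)
      (a := MulOpposite.op b) (s := MulOpposite.op s) (p := p)
      (fun x hx => by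
        obtain ⟨y, hy⟩ := hI x.unop (TwoSidedIdeal.mem_op_iff.mp hx)
        exact ⟨MulOpposite.op y, MulOpposite.unop_injective (by simpa [mul_assoc] using hy)⟩)
      (TwoSidedIdeal.mem_op_iff.mpr (by simpa using hs))
      (fun x hx => MulOpposite.unop_injective (by
        have := hp x.unop (by simpa using congrArg MulOpposite.unop hx)
        simpa using this))
  have haP' : P.unop * b = b * P.unop := congrArg MulOpposite.unop haP
  refine ⟨P.unop, TwoSidedIdeal.mem_op_iff.mp hPI, congrArg MulOpposite.unop hPP, haP'.symm,
    ⟨n, ?_⟩, l.unop, congrArg MulOpposite.unop hl, (congrArg MulOpposite.unop hlP).symm,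
    congrArg MulOpposite.unop hlP'⟩
  rw [((show Commute P.unop b from haP').pow_right n).symm.eq]
  simpa using congrArg MulOpposite.unop hn

/-! ### Linear maps with finite index -/

/-- The linear map `f` has finite-dimensional kernel and cokernel, and its index
`dim ker f - dim coker f` is `n`; this excludes the junk values of `LinearMap.index`. -/
def LinearMap.HasIndex {K V W : Type*} [Field K] [AddCommGroup V] [Module K V] [AddCommGroup W]
    [Module K W] (f : V →ₗ[K] W) (n : ℤ) : Prop :=
  FiniteDimensional K (LinearMap.ker f) ∧ FiniteDimensional K (W ⧸ LinearMap.range f) ∧ f.index = n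

namespace LinearMap.HasIndex

open Module

variable {K V W U : Type*} [Field K] [AddCommGroup V] [Module K V] [AddCommGroup W] [Module K W]
  [AddCommGroup U] [Module K U]

theorem comp {g : W →ₗ[K] U} {f : V →ₗ[K] W} {m n : ℤ} (hg : g.HasIndex m) (hf : f.HasIndex n) :
    (g ∘ₗ f).HasIndex (m + n) := by
  obtain ⟨_, _, rfl⟩ := hg
  obtain ⟨_, _, rfl⟩ := hf
  refine ⟨?_, ?_, LinearMap.index_comp g⟩
  · rw [LinearMap.ker_comp]; infer_instance
  · rw [LinearMap.range_comp]; infer_instance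

theorem of_surjective {f : V →ₗ[K] W} (hf : Function.Surjective f) [FiniteDimensional K f.ker] :
    f.HasIndex (finrank K f.ker) := by
  refine ⟨inferInstance, ?_, LinearMap.index_of_surjective hf⟩
  rw [LinearMap.range_eq_top.mpr hf]
  infer_instance

theorem of_injective {f : V →ₗ[K] W} (hf : Function.Injective f)
    [FiniteDimensional K (W ⧸ f.range)] : f.HasIndex (-finrank K (W ⧸ f.range)) := by
  refine ⟨?_, inferInstance, LinearMap.index_of_injective hf⟩
  rw [LinearMap.ker_eq_bot.mpr hf]
  infer_instance

theorem of_equiv (e : V ≃ₗ[K] W) : (e : V →ₗ[K] W).HasIndex 0 := by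
  have h : FiniteDimensional K (LinearMap.ker (e : V →ₗ[K] W)) := by
    rw [LinearEquiv.ker]; infer_instance
  obtain ⟨h1, h2, -⟩ := of_surjective (f := (e : V →ₗ[K] W)) e.surjective
  exact ⟨h1, h2, LinearEquiv.index_eq_zero⟩

theorem fst [FiniteDimensional K W] : (LinearMap.fst K V W).HasIndex (finrank K W) := by
  have e : W ≃ₗ[K] LinearMap.ker (LinearMap.fst K V W) :=
    (LinearEquiv.ofInjective (LinearMap.inr K V W) LinearMap.inr_injective).trans
      (LinearEquiv.ofEq _ _ (LinearMap.range_inr K V W))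
  have := e.finiteDimensional
  rw [e.finrank_eq]
  exact of_surjective LinearMap.fst_surjective

theorem snd [FiniteDimensional K V] : (LinearMap.snd K V W).HasIndex (finrank K V) := by
  have e : V ≃ₗ[K] LinearMap.ker (LinearMap.snd K V W) :=
    (LinearEquiv.ofInjective (LinearMap.inl K V W) LinearMap.inl_injective).trans
      (LinearEquiv.ofEq _ _ (LinearMap.range_inl K V W))
  have := e.finiteDimensional
  rw [e.finrank_eq]
  exact of_surjective LinearMap.snd_surjective

theorem inl [FiniteDimensional K W] : (LinearMap.inl K V W).HasIndex (-finrank K W) := by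
  have e : ((V × W) ⧸ LinearMap.range (LinearMap.inl K V W)) ≃ₗ[K] W :=
    (Submodule.quotEquivOfEq _ _ (LinearMap.range_inl K V W)).trans
      ((LinearMap.snd K V W).quotKerEquivOfSurjective LinearMap.snd_surjective)
  have := e.symm.finiteDimensional
  rw [← e.finrank_eq]
  exact of_injective LinearMap.inl_injective

theorem inr [FiniteDimensional K V] : (LinearMap.inr K V W).HasIndex (-finrank K V) := by
  have e : ((V × W) ⧸ LinearMap.range (LinearMap.inr K V W)) ≃ₗ[K] V :=
    (Submodule.quotEquivOfEq _ _ (LinearMap.range_inr K V W)).trans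
      ((LinearMap.fst K V W).quotKerEquivOfSurjective LinearMap.fst_surjective)
  have := e.symm.finiteDimensional
  rw [← e.finrank_eq]
  exact of_injective LinearMap.inr_injective

theorem pow {f : Module.End K V} {n : ℤ} (hf : LinearMap.HasIndex f n) (k : ℕ) :
    LinearMap.HasIndex (f ^ k) (k * n) := by
  induction k with
  | zero =>
    rw [pow_zero, Nat.cast_zero, zero_mul]
    exact of_equiv (LinearEquiv.refl K V)
  | succ k ih =>
    rw [pow_succ, show ((k + 1 : ℕ) : ℤ) * n = k * n + n by push_cast; ring]
    exact ih.comp hf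

/-- Consecutive powers of `f` have indices differing by the index of `f`, so the latter vanishes
once both the kernels and the ranges of the powers of `f` stabilise. -/
theorem eq_zero_of_pow {f : Module.End K V} {n : ℤ} (hf : LinearMap.HasIndex f n) {k : ℕ}
    (hk : LinearMap.ker (f ^ k) = LinearMap.ker (f ^ (k + 1)))
    (hr : LinearMap.range (f ^ k) = LinearMap.range (f ^ (k + 1))) : n = 0 := by
  have h1 := (hf.pow k).2.2
  have h2 := (hf.pow (k + 1)).2.2
  rw [LinearMap.index_eq_finrank_sub, ← hk, ← hr, ← LinearMap.index_eq_finrank_sub, h1] at h2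
  push_cast at h2
  linarith

/-- A finite-rank perturbation of the identity has index zero: both its kernel and its cokernel are
those of its restriction to the range of the perturbation. -/
theorem id_sub (F : V →ₗ[K] V) [FiniteDimensional K F.range] :
    (LinearMap.id - F).HasIndex 0 := by
  let g : F.range →ₗ[K] F.range :=
    LinearMap.id - F.rangeRestrict ∘ₗ F.range.subtype
  have hg : ∀ w : F.range, ((g w : F.range) : V) = w - F w := fun w => rfl
  have hker : (LinearMap.ker g).map F.range.subtype = LinearMap.ker (LinearMap.id - F) := by
    ext x
    constructor
    · rintro ⟨w, hw, rfl⟩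
      exact congrArg Subtype.val (show g w = 0 from hw)
    · intro hx
      have hx' : x = F x := sub_eq_zero.mp hx
      exact ⟨⟨x, x, hx'.symm⟩, Subtype.ext hx, rfl⟩
  let c : F.range →ₗ[K] V ⧸ LinearMap.range (LinearMap.id - F) :=
    (LinearMap.range (LinearMap.id - F)).mkQ ∘ₗ F.range.subtype
  have hc : Function.Surjective c := by
    intro y
    obtain ⟨v, rfl⟩ := Submodule.mkQ_surjective _ y
    refine ⟨⟨F v, v, rfl⟩, ?_⟩
    refine (Submodule.Quotient.eq _).mpr ⟨-v, ?_⟩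
    simp [neg_add_eq_sub]
  have hcker : LinearMap.ker c = LinearMap.range g := by
    ext w
    have h1 : w ∈ LinearMap.ker c ↔ (w : V) ∈ LinearMap.range (LinearMap.id - F) :=
      Submodule.Quotient.mk_eq_zero _
    rw [h1]
    constructor
    · rintro ⟨v, hv⟩
      have hv' : v - F v = w := hv
      have hvF : v ∈ F.range := by
        rw [sub_eq_iff_eq_add.mp hv']
        exact add_mem w.2 ⟨v, rfl⟩
      exact ⟨⟨v, hvF⟩, Subtype.ext hv'⟩
    · rintro ⟨v, rfl⟩
      exact ⟨v, (hg v).symm⟩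
  have e : (F.range ⧸ LinearMap.range g) ≃ₗ[K] V ⧸ LinearMap.range (LinearMap.id - F) :=
    (Submodule.quotEquivOfEq _ _ hcker.symm).trans (c.quotKerEquivOfSurjective hc)
  refine ⟨?_, e.finiteDimensional, ?_⟩
  · rw [← hker]
    infer_instance
  · have h0 : g.index = 0 := by rw [LinearMap.index_eq_of_finiteDimensional, sub_self]
    rw [LinearMap.index_eq_finrank_sub] at h0 ⊢
    rw [← hker, ← e.finrank_eq, Submodule.finrank_map_subtype_eq, h0]

/-- The snake lemma for an upper triangular map `M (x, y) = (A x + C y, B y)`: the kernel of `M` is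
an extension of the kernel of the connecting map `ker B → coker A`, `y ↦ [C y]`, by `ker A`, and
the cokernel of `M` is an extension of `coker B` by the cokernel of the connecting map. -/
theorem connecting {A : V →ₗ[K] V} {B : W →ₗ[K] W} {C : W →ₗ[K] V} {M : V × W →ₗ[K] V × W}
    (hM : ∀ x y, M (x, y) = (A x + C y, B y)) {n : ℤ} (h : M.HasIndex n) :
    (A.range.mkQ ∘ₗ C ∘ₗ B.ker.subtype).HasIndex
      (n - finrank K A.ker + finrank K (W ⧸ B.range)) := by
  obtain ⟨hk, hc, hn⟩ := h
  let δ : B.ker →ₗ[K] V ⧸ A.range := A.range.mkQ ∘ₗ C ∘ₗ B.ker.subtype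
  have hδ0 : ∀ y : B.ker, δ y = 0 ↔ C y ∈ A.range := fun y => Submodule.Quotient.mk_eq_zero _
  let i : A.ker →ₗ[K] M.ker := (LinearMap.inl K V W ∘ₗ A.ker.subtype).codRestrict _ fun x => by
    have hx : A x = 0 := x.2
    simp [hM, hx]
  let g : M.ker →ₗ[K] B.ker := (LinearMap.snd K V W ∘ₗ M.ker.subtype).codRestrict _ fun z => by
    have hz : M (z.1.1, z.1.2) = 0 := z.2
    rw [hM] at hz
    exact (Prod.ext_iff.mp hz).2
  have hi : Function.Injective i := fun x y hxy =>
    Subtype.ext (Prod.ext_iff.mp (congrArg Subtype.val hxy)).1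
  have hgi : LinearMap.ker g = LinearMap.range i := by
    ext z
    constructor
    · intro hz
      have hz2 : z.1.2 = 0 := congrArg Subtype.val (show g z = 0 from hz)
      have hz1 : M (z.1.1, z.1.2) = 0 := z.2
      rw [hM, hz2, map_zero, add_zero] at hz1
      exact ⟨⟨z.1.1, (Prod.ext_iff.mp hz1).1⟩, Subtype.ext (Prod.ext rfl hz2.symm)⟩
    · rintro ⟨x, rfl⟩
      exact Subtype.ext rfl
  have hgr : LinearMap.range g = LinearMap.ker δ := by
    ext y
    rw [LinearMap.mem_ker, hδ0]
    constructor
    · rintro ⟨z, rfl⟩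
      have hz : M (z.1.1, z.1.2) = 0 := z.2
      rw [hM] at hz
      refine ⟨-z.1.1, ?_⟩
      rw [map_neg]
      exact neg_eq_of_add_eq_zero_right (Prod.ext_iff.mp hz).1
    · rintro ⟨x, hx⟩
      have hy : B y = 0 := y.2
      exact ⟨⟨(-x, y), by simp [hM, hx, hy]⟩, rfl⟩
  let j : (V ⧸ A.range) →ₗ[K] (V × W) ⧸ M.range :=
    A.range.mapQ M.range (LinearMap.inl K V W) (by
      rintro _ ⟨x, rfl⟩
      exact ⟨(x, 0), by simp [hM]⟩)
  let p : ((V × W) ⧸ M.range) →ₗ[K] W ⧸ B.range :=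
    M.range.mapQ B.range (LinearMap.snd K V W) (by
      rintro _ ⟨⟨x, y⟩, rfl⟩
      exact ⟨y, by simp [hM]⟩)
  have hp : Function.Surjective p := by
    intro y
    obtain ⟨y, rfl⟩ := Submodule.mkQ_surjective _ y
    exact ⟨M.range.mkQ (0, y), rfl⟩
  have hj : LinearMap.ker j = LinearMap.range δ := by
    ext v
    obtain ⟨v, rfl⟩ := Submodule.mkQ_surjective _ v
    have h1 : A.range.mkQ v ∈ LinearMap.ker j ↔ (v, (0 : W)) ∈ M.range :=
      Submodule.Quotient.mk_eq_zero _
    rw [h1]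
    constructor
    · rintro ⟨⟨x, y⟩, hxy⟩
      rw [hM] at hxy
      obtain ⟨h2, h3⟩ := Prod.ext_iff.mp hxy
      refine ⟨⟨y, h3⟩, (Submodule.Quotient.eq _).mpr ⟨-x, ?_⟩⟩
      rw [map_neg, ← show A x + C y = v from h2]
      simp
    · rintro ⟨y, hy⟩
      obtain ⟨x, hx⟩ := (Submodule.Quotient.eq _).mp hy
      have hy0 : B y = 0 := y.2
      have hx' : A x = C y - v := hx
      exact ⟨(-x, y), by simp [hM, hy0, hx']⟩
  have hpj : LinearMap.ker p = LinearMap.range j := by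
    ext z
    obtain ⟨⟨v, w⟩, rfl⟩ := Submodule.mkQ_surjective _ z
    have h1 : M.range.mkQ (v, w) ∈ LinearMap.ker p ↔ w ∈ B.range :=
      Submodule.Quotient.mk_eq_zero _
    rw [h1]
    constructor
    · rintro ⟨y, hy⟩
      refine ⟨A.range.mkQ (v - C y), (Submodule.Quotient.eq _).mpr ⟨(0, -y), ?_⟩⟩
      simp [hM, hy]
    · rintro ⟨x, hx⟩
      obtain ⟨x, rfl⟩ := Submodule.mkQ_surjective _ x
      obtain ⟨⟨x', y'⟩, h2⟩ := (Submodule.Quotient.eq _).mp hx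
      rw [hM] at h2
      have h3 : B y' = 0 - w := (Prod.ext_iff.mp h2).2
      exact ⟨-y', by rw [map_neg, h3]; simp⟩
  have e : ((V ⧸ A.range) ⧸ LinearMap.range δ) ≃ₗ[K] LinearMap.ker p :=
    (Submodule.quotEquivOfEq _ _ hj.symm).trans
      (j.quotKerEquivRange.trans (LinearEquiv.ofEq _ _ hpj.symm))
  have h1 := LinearMap.finrank_range_add_finrank_ker g
  have h2 := LinearMap.finrank_range_add_finrank_ker p
  rw [hgr, hgi, LinearMap.finrank_range_of_inj hi] at h1
  rw [LinearMap.range_eq_top.mpr hp, finrank_top, ← e.finrank_eq] at h2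
  have hfk : FiniteDimensional K (LinearMap.ker δ) := by rw [← hgr]; infer_instance
  refine ⟨hfk, e.symm.finiteDimensional, ?_⟩
  rw [LinearMap.index_eq_finrank_sub] at hn ⊢
  change (finrank K (LinearMap.ker δ) : ℤ) - finrank K ((V ⧸ A.range) ⧸ LinearMap.range δ) = _
  omega

/-- If `A'` is left invertible and agrees with `A` up to finite rank, with `range A ≤ range A'`,
then `range A` has codimension `dim ker A` in `range A'`. -/
theorem factor {A A' L : V →ₗ[K] V} (hL : L ∘ₗ A' = LinearMap.id) (hA : A' ∘ₗ L ∘ₗ A = A)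
    (h : (L ∘ₗ A).HasIndex 0) (hle : A.range ≤ A'.range) :
    (Submodule.factor hle).HasIndex (finrank K A.ker) := by
  obtain ⟨hk, hc, hi⟩ := h
  have hker : (L ∘ₗ A).ker = A.ker := by
    ext x
    constructor
    · intro hx
      have h1 : A' (L (A x)) = A x := LinearMap.congr_fun hA x
      have h2 : L (A x) = 0 := hx
      rw [h2, map_zero] at h1
      exact h1.symm
    · intro hx
      have h1 : A x = 0 := hx
      simp [h1]
  let c : V →ₗ[K] V ⧸ A.range := A.range.mkQ ∘ₗ A'
  have hcker : c.ker = (L ∘ₗ A).range := by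
    ext x
    have h1 : x ∈ c.ker ↔ A' x ∈ A.range := Submodule.Quotient.mk_eq_zero _
    rw [h1]
    constructor
    · rintro ⟨z, hz⟩
      refine ⟨z, ?_⟩
      rw [LinearMap.comp_apply, hz]
      exact LinearMap.congr_fun hL x
    · rintro ⟨z, rfl⟩
      exact ⟨z, (LinearMap.congr_fun hA z).symm⟩
  have hcr : c.range = (Submodule.factor hle).ker := by
    ext v
    obtain ⟨v, rfl⟩ := Submodule.mkQ_surjective _ v
    have h1 : A.range.mkQ v ∈ (Submodule.factor hle).ker ↔ v ∈ A'.range :=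
      Submodule.Quotient.mk_eq_zero _
    rw [h1]
    constructor
    · rintro ⟨x, hx⟩
      have h2 : A' x - v ∈ A.range := (Submodule.Quotient.eq _).mp hx
      have h3 := sub_mem (⟨x, rfl⟩ : A' x ∈ A'.range) (hle h2)
      rwa [sub_sub_cancel] at h3
    · rintro ⟨x, rfl⟩
      exact ⟨x, rfl⟩
  have e : (V ⧸ (L ∘ₗ A).range) ≃ₗ[K] (Submodule.factor hle).ker :=
    (Submodule.quotEquivOfEq _ _ hcker.symm).trans
      (c.quotKerEquivRange.trans (LinearEquiv.ofEq _ _ hcr))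
  have := e.finiteDimensional
  have hdim : finrank K A.ker = finrank K (Submodule.factor hle).ker := by
    rw [LinearMap.index_eq_finrank_sub, hker, e.finrank_eq] at hi
    omega
  rw [hdim]
  exact of_surjective (Submodule.factor_surjective hle)

/-- If `B'` is right invertible and agrees with `B` up to finite rank, with `ker B' ≤ ker B`,
then `ker B'` has codimension `dim coker B` in `ker B`. -/
theorem inclusion {B B' R : W →ₗ[K] W} (hR : B' ∘ₗ R = LinearMap.id) (hB : B ∘ₗ R ∘ₗ B' = B)
    (h : (B ∘ₗ R).HasIndex 0) (hle : B'.ker ≤ B.ker) :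
    (Submodule.inclusion hle).HasIndex (-finrank K (W ⧸ B.range)) := by
  obtain ⟨hk, hc, hi⟩ := h
  have hrange : (B ∘ₗ R).range = B.range := by
    refine le_antisymm (LinearMap.range_comp_le_range R B) ?_
    rintro _ ⟨x, rfl⟩
    exact ⟨B' x, LinearMap.congr_fun hB x⟩
  let r : (B ∘ₗ R).ker →ₗ[K] B.ker ⧸ (Submodule.inclusion hle).range :=
    (Submodule.inclusion hle).range.mkQ ∘ₗ
      (R ∘ₗ (B ∘ₗ R).ker.subtype).codRestrict _ fun z => z.2
  have hr : Function.Bijective r := by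
    constructor
    · rw [← LinearMap.ker_eq_bot, LinearMap.ker_eq_bot']
      intro z hz
      obtain ⟨y, hy⟩ := (Submodule.Quotient.mk_eq_zero _).mp hz
      have h1 : (y : W) = R z := congrArg Subtype.val hy
      have h2 : B' y = 0 := y.2
      rw [h1] at h2
      exact Subtype.ext ((LinearMap.congr_fun hR z).symm.trans h2)
    · intro y
      obtain ⟨y, rfl⟩ := Submodule.mkQ_surjective _ y
      have h1 : B (R (B' y)) = 0 := (LinearMap.congr_fun hB y).trans y.2
      refine ⟨⟨B' y, h1⟩, (Submodule.Quotient.eq _).mpr ⟨⟨R (B' y) - y, ?_⟩, rfl⟩⟩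
      have h2 : B' (R (B' y)) = B' y := LinearMap.congr_fun hR (B' y)
      rw [LinearMap.mem_ker, map_sub, h2, sub_self]
  have e := LinearEquiv.ofBijective r hr
  have := e.finiteDimensional
  have hdim : finrank K (W ⧸ B.range) =
      finrank K (B.ker ⧸ (Submodule.inclusion hle).range) := by
    rw [LinearMap.index_eq_finrank_sub, hrange, e.finrank_eq] at hi
    omega
  rw [hdim]
  exact of_injective (Submodule.inclusion_injective hle)

end LinearMap.HasIndex

/-! ### The ideal of finite-rank operators -/

section FiniteRank

variable {X : Type*} [NormedAddCommGroup X] [NormedSpace ℂ X]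

/-- The two-sided ideal of bounded operators of finite rank. -/
def finiteRankIdeal (X : Type*) [NormedAddCommGroup X] [NormedSpace ℂ X] :
    TwoSidedIdeal (X →L[ℂ] X) :=
  TwoSidedIdeal.mk' {T | (T : X →ₗ[ℂ] X).HasFiniteRange}
    LinearMap.HasFiniteRange.zero
    (fun h₁ h₂ => LinearMap.HasFiniteRange.add h₁ h₂)
    (fun h => LinearMap.HasFiniteRange.neg h)
    (fun {S _} h => LinearMap.HasFiniteRange.comp_left h (S : X →ₗ[ℂ] X))
    (fun {_ S} h => LinearMap.HasFiniteRange.comp_right h (S : X →ₗ[ℂ] X))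

theorem mem_finiteRankIdeal {T : X →L[ℂ] X} :
    T ∈ finiteRankIdeal X ↔ (T : X →ₗ[ℂ] X).HasFiniteRange :=
  TwoSidedIdeal.mem_mk' _ _ _ _ _ _ _

theorem finiteDimensional_range_of_mem {T : X →L[ℂ] X} (h : T ∈ finiteRankIdeal X) :
    FiniteDimensional ℂ (opRange T) :=
  Module.Finite.of_fg (mem_finiteRankIdeal.mp h)

theorem mem_finiteRankIdeal_of_forall_mem {T : X →L[ℂ] X} (V : Submodule ℂ X)
    [FiniteDimensional ℂ V] (h : ∀ x, T x ∈ V) : T ∈ finiteRankIdeal X := by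
  have hle : opRange T ≤ V := by
    rintro _ ⟨x, rfl⟩
    exact h x
  have := Submodule.finiteDimensional_of_le hle
  exact mem_finiteRankIdeal.mpr (Submodule.FG.of_finite)

/-- Finite-rank operators are von Neumann regular. -/
theorem exists_mul_mul_eq_of_mem_finiteRankIdeal (T : X →L[ℂ] X) (hT : T ∈ finiteRankIdeal X) :
    ∃ S : X →L[ℂ] X, T * S * T = T := by
  have := finiteDimensional_range_of_mem hT
  obtain ⟨q, hq⟩ := Submodule.ClosedComplemented.of_finiteDimensional (𝕜 := ℂ) (opRange T)
  obtain ⟨s, hs⟩ := (T : X →ₗ[ℂ] X).rangeRestrict.exists_rightInverse_of_surjective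
    (LinearMap.range_rangeRestrict _)
  refine ⟨s.toContinuousLinearMap.comp q, ?_⟩
  ext x
  have h1 : q (T x) = ⟨T x, x, rfl⟩ := hq ⟨T x, x, rfl⟩
  have h2 := congrArg Subtype.val (LinearMap.congr_fun hs ⟨T x, x, rfl⟩)
  change T (s (q (T x))) = T x
  rw [h1]
  exact h2

end FiniteRank

/-! ### Semi-Fredholm operators as one-sided invertibles modulo finite rank -/

section SemiFredholm

variable {X : Type*} [NormedAddCommGroup X] [NormedSpace ℂ X]

theorem closedComplemented_opRange_of_mul_mul_eq {T U : X →L[ℂ] X} (h : T * U * T = T) :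
    (opRange T).ClosedComplemented := by
  refine ⟨(T * U).codRestrict (opRange T) fun x => ⟨U x, rfl⟩, ?_⟩
  rintro ⟨_, x, rfl⟩
  exact Subtype.ext (DFunLike.congr_fun h x)

theorem closedComplemented_opKer_of_mul_mul_eq {T U : X →L[ℂ] X} (h : T * U * T = T) :
    (opKer T).ClosedComplemented := by
  refine ⟨(1 - U * T).codRestrict (opKer T) fun x => ?_, fun x => ?_⟩
  · change T (x - U (T x)) = 0
    rw [map_sub, sub_eq_zero]
    exact (DFunLike.congr_fun h x).symm
  · have hx : T x = 0 := x.2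
    exact Subtype.ext (by simp [hx])

theorem isLeftSemiFredholm_of_one_sub_mul_mem {T S : X →L[ℂ] X}
    (h : 1 - S * T ∈ finiteRankIdeal X) : IsLeftSemiFredholm T := by
  obtain ⟨U, hU⟩ := exists_mul_mul_eq_self_of_one_sub_mul_mem
    exists_mul_mul_eq_of_mem_finiteRankIdeal h
  have hc := closedComplemented_opRange_of_mul_mul_eq hU
  refine ⟨hc.isClosed, hc, ?_⟩
  have := finiteDimensional_range_of_mem h
  refine Submodule.finiteDimensional_of_le (S₂ := opRange (1 - S * T)) fun x hx => ⟨x, ?_⟩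
  have hx' : T x = 0 := hx
  simp [hx']

theorem isRightSemiFredholm_of_one_sub_mul_mem {T S : X →L[ℂ] X}
    (h : 1 - T * S ∈ finiteRankIdeal X) : IsRightSemiFredholm T := by
  obtain ⟨U, hU⟩ := exists_mul_mul_eq_self_of_one_sub_mul_mem_right
    exists_mul_mul_eq_of_mem_finiteRankIdeal h
  refine ⟨T.isClosed_ker, closedComplemented_opKer_of_mul_mul_eq hU, ?_⟩
  have h1 : (opKer (1 - T * S)).CoFG := LinearMap.HasFiniteRange.cofg_ker (mem_finiteRankIdeal.mp h)
  refine Submodule.CoFG.of_le (fun x hx => ⟨S x, ?_⟩) h1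
  exact (sub_eq_zero.mp (show x - T (S x) = 0 from hx)).symm

variable [CompleteSpace X]

theorem IsLeftSemiFredholm.exists_one_sub_mul_mem {T : X →L[ℂ] X} (h : IsLeftSemiFredholm T) :
    ∃ S : X →L[ℂ] X, 1 - S * T ∈ finiteRankIdeal X := by
  obtain ⟨hcl, ⟨r, hr⟩, hk⟩ := h
  obtain ⟨q, hq, hcompl⟩ := (Submodule.ClosedComplemented.of_finiteDimensional (𝕜 := ℂ)
    (opKer T)).exists_isClosed_isCompl
  have := hq.completeSpace_coe
  have := hcl.completeSpace_coe
  have hsum : ∀ x, ∃ u ∈ opKer T, ∃ v ∈ q, u + v = x := fun x =>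
    Submodule.mem_sup.mp (hcompl.sup_eq_top ▸ Submodule.mem_top (x := x))
  -- `T` restricts to an isomorphism from a closed complement of its kernel onto its range.
  let e : q ≃L[ℂ] opRange T := ContinuousLinearEquiv.ofBijective
    ((T.comp q.subtypeL).codRestrict (opRange T) fun x => ⟨x, rfl⟩)
    (LinearMap.ker_eq_bot'.mpr fun x hx => Subtype.ext
      (Submodule.disjoint_def.mp hcompl.disjoint x (congrArg Subtype.val hx) x.2))
    (LinearMap.range_eq_top.mpr (by
      rintro ⟨_, x, rfl⟩
      obtain ⟨u, hu, v, hv, rfl⟩ := hsum x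
      have hu0 : T u = 0 := hu
      exact ⟨⟨v, hv⟩, Subtype.ext (show T v = T (u + v) by rw [map_add, hu0, zero_add])⟩))
  have he : ∀ v : q, e.symm (r (T v)) = v := fun v => by
    have h1 : r (T v) = e v := hr ⟨T v, v, rfl⟩
    rw [h1, e.symm_apply_apply]
  refine ⟨q.subtypeL.comp ((e.symm : opRange T →L[ℂ] q).comp r),
    mem_finiteRankIdeal_of_forall_mem (opKer T) fun x => ?_⟩
  obtain ⟨u, hu, v, hv, rfl⟩ := hsum x
  have hu0 : T u = 0 := hu
  have h1 : (e.symm (r (T v)) : X) = v := congrArg Subtype.val (he ⟨v, hv⟩)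
  have h2 : (1 - q.subtypeL.comp ((e.symm : opRange T →L[ℂ] q).comp r) * T) (u + v) = u := by
    change u + v - (e.symm (r (T (u + v))) : X) = u
    rw [map_add, hu0, zero_add, h1, add_sub_cancel_right]
  rw [h2]
  exact hu

theorem IsRightSemiFredholm.exists_one_sub_mul_mem {T : X →L[ℂ] X} (h : IsRightSemiFredholm T) :
    ∃ S : X →L[ℂ] X, 1 - T * S ∈ finiteRankIdeal X := by
  obtain ⟨-, hkc, hc⟩ := h
  obtain ⟨q, hq, hcompl⟩ := hkc.exists_isClosed_isCompl
  obtain ⟨G, hG⟩ := (opRange T).exists_isCompl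
  have : FiniteDimensional ℂ G :=
    LinearEquiv.finiteDimensional (Submodule.quotientEquivOfIsCompl _ _ hG)
  have := hq.completeSpace_coe
  -- `(v, g) ↦ T v + g` is an isomorphism, where `q` is a closed complement of the kernel of `T`
  -- and `G` one of its range.
  let e : (q × G) ≃L[ℂ] X := ContinuousLinearEquiv.ofBijective
    ((T.comp q.subtypeL).coprod G.subtypeL)
    (LinearMap.ker_eq_bot'.mpr (by
      rintro ⟨v, g⟩ hx
      have hx' : T v + g = 0 := hx
      have h1 : (g : X) = 0 := Submodule.disjoint_def.mp hG.disjoint g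
        ⟨-v, by rw [map_neg]; exact neg_eq_of_add_eq_zero_right hx'⟩ g.2
      rw [h1, add_zero] at hx'
      exact Prod.ext (Subtype.ext (Submodule.disjoint_def.mp hcompl.disjoint v hx' v.2))
        (Subtype.ext h1)))
    (LinearMap.range_eq_top.mpr (by
      intro x
      obtain ⟨_, ⟨y, rfl⟩, g, hg, rfl⟩ :=
        Submodule.mem_sup.mp (hG.sup_eq_top ▸ Submodule.mem_top (x := x))
      obtain ⟨u, hu, v, hv, rfl⟩ :=
        Submodule.mem_sup.mp (hcompl.sup_eq_top ▸ Submodule.mem_top (x := y))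
      have hu0 : T u = 0 := hu
      exact ⟨(⟨v, hv⟩, ⟨g, hg⟩), by simp [hu0]⟩))
  refine ⟨q.subtypeL.comp ((ContinuousLinearMap.fst ℂ q G).comp (e.symm : X →L[ℂ] q × G)),
    mem_finiteRankIdeal_of_forall_mem G fun x => ?_⟩
  have h1 : T (e.symm x).1 + (e.symm x).2 = x := e.apply_symm_apply x
  have h2 : (1 - T * q.subtypeL.comp
      ((ContinuousLinearMap.fst ℂ q G).comp (e.symm : X →L[ℂ] q × G))) x = (e.symm x).2 := by
    change x - T (e.symm x).1 = (e.symm x).2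
    rw [sub_eq_iff_eq_add']
    exact h1.symm
  rw [h2]
  exact (e.symm x).2.2

theorem IsRightSemiFredholm.isClosed_opRange {T : X →L[ℂ] X} (h : IsRightSemiFredholm T) :
    IsClosed (opRange T : Set X) := by
  obtain ⟨S, hS⟩ := h.exists_one_sub_mul_mem
  obtain ⟨U, hU⟩ := exists_mul_mul_eq_self_of_one_sub_mul_mem_right
    exists_mul_mul_eq_of_mem_finiteRankIdeal hS
  exact (closedComplemented_opRange_of_mul_mul_eq hU).isClosed

end SemiFredholm

/-! ### Operators of index zero -/

/-- A bounded operator of index zero between Banach spaces becomes an isomorphism after a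
finite-rank perturbation. -/
theorem LinearMap.HasIndex.nonempty_continuousLinearEquiv {E F : Type*} [NormedAddCommGroup E]
    [NormedSpace ℂ E] [CompleteSpace E] [NormedAddCommGroup F] [NormedSpace ℂ F] [CompleteSpace F]
    {T : E →L[ℂ] F} (hT : (T : E →ₗ[ℂ] F).HasIndex 0) : Nonempty (E ≃L[ℂ] F) := by
  obtain ⟨hk, hc, hi⟩ := hT
  obtain ⟨k, hkk⟩ := Submodule.ClosedComplemented.of_finiteDimensional (𝕜 := ℂ)
    (LinearMap.ker (T : E →ₗ[ℂ] F))
  obtain ⟨D, hD⟩ := (LinearMap.range (T : E →ₗ[ℂ] F)).exists_isCompl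
  have eD := Submodule.quotientEquivOfIsCompl _ _ hD
  have := eD.finiteDimensional
  let φ : LinearMap.ker (T : E →ₗ[ℂ] F) ≃ₗ[ℂ] D := LinearEquiv.ofFinrankEq _ _ (by
    rw [← eD.finrank_eq]
    rw [LinearMap.index_eq_finrank_sub] at hi
    omega)
  let T' : E →L[ℂ] F := T + D.subtypeL.comp ((φ : _ →ₗ[ℂ] D).toContinuousLinearMap.comp k)
  have hT' : ∀ x, T' x = T x + φ (k x) := fun x => rfl
  refine ⟨ContinuousLinearEquiv.ofBijective T' (LinearMap.ker_eq_bot'.mpr fun x hx => ?_)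
    (LinearMap.range_eq_top.mpr fun y => ?_)⟩
  · have hx' : T x + φ (k x) = 0 := hx
    have h1 : (φ (k x) : F) = 0 := Submodule.disjoint_def.mp hD.disjoint _
      ⟨-x, by rw [map_neg]; exact neg_eq_of_add_eq_zero_right hx'⟩ (φ (k x)).2
    have h2 : k x = 0 := φ.map_eq_zero_iff.mp (Subtype.ext h1)
    rw [h1, add_zero] at hx'
    have h3 : k x = ⟨x, hx'⟩ := hkk ⟨x, hx'⟩
    exact congrArg Subtype.val (h3.symm.trans h2)
  · obtain ⟨_, ⟨x, rfl⟩, d, hd, rfl⟩ :=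
      Submodule.mem_sup.mp (hD.sup_eq_top ▸ Submodule.mem_top (x := y))
    -- The component of `x` in the kernel of `T` is replaced by the one mapping to `d`.
    refine ⟨x - k x + φ.symm ⟨d, hd⟩, ?_⟩
    have h1 : T (k x) = 0 := (k x).2
    have h2 : T (φ.symm ⟨d, hd⟩) = 0 := (φ.symm ⟨d, hd⟩).2
    change T' _ = _
    rw [hT', map_add k, map_sub k, hkk, hkk, sub_self, zero_add, LinearEquiv.apply_symm_apply,
      map_add, map_sub, h1, h2, sub_zero, add_zero]
    rfl

/-! ### Browder and semi-Browder operators -/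

section Browder

variable {X : Type*} [NormedAddCommGroup X] [NormedSpace ℂ X]

theorem ascent_lt_top_iff {T : X →L[ℂ] X} :
    ascent T < ⊤ ↔ ∃ k : ℕ, opKer (T ^ k) = opKer (T ^ (k + 1)) := by
  simp [ascent, iInf_lt_iff]

theorem descent_lt_top_iff {T : X →L[ℂ] X} :
    descent T < ⊤ ↔ ∃ k : ℕ, opRange (T ^ k) = opRange (T ^ (k + 1)) := by
  simp [descent, iInf_lt_iff]

theorem opKer_pow_eq_of_le {T : X →L[ℂ] X} {k m : ℕ} (h : opKer (T ^ k) = opKer (T ^ (k + 1)))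
    (hkm : k ≤ m) : opKer (T ^ m) = opKer (T ^ k) := by
  induction m, hkm using Nat.le_induction with
  | base => rfl
  | succ m hm ih =>
    rw [← ih]
    obtain ⟨d, rfl⟩ := Nat.exists_eq_add_of_le hm
    ext x
    have hx : (T ^ d) x ∈ opKer (T ^ k) ↔ (T ^ d) x ∈ opKer (T ^ (k + 1)) := by rw [h]
    have h1 : (T ^ (k + d + 1)) x = (T ^ (k + 1)) ((T ^ d) x) := by
      rw [show k + d + 1 = (k + 1) + d by ring, pow_add]; rfl
    have h2 : (T ^ (k + d)) x = (T ^ k) ((T ^ d) x) := by rw [pow_add]; rfl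
    change (T ^ (k + d + 1)) x = 0 ↔ (T ^ (k + d)) x = 0
    rw [h1, h2]
    exact hx.symm

theorem opRange_pow_eq_of_le {T : X →L[ℂ] X} {k m : ℕ}
    (h : opRange (T ^ k) = opRange (T ^ (k + 1))) (hkm : k ≤ m) :
    opRange (T ^ m) = opRange (T ^ k) := by
  induction m, hkm using Nat.le_induction with
  | base => rfl
  | succ m hm ih =>
    rw [← ih]
    obtain ⟨d, rfl⟩ := Nat.exists_eq_add_of_le hm
    have key : ∀ j, opRange (T ^ (d + j)) =
        (opRange (T ^ j)).map (T ^ d : X →L[ℂ] X).toLinearMap := by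
      intro j
      rw [pow_add]
      exact LinearMap.range_comp _ _
    rw [show k + d + 1 = d + (k + 1) by ring, add_comm k d, key, key, h]

/-- An operator that splits along a finite-rank idempotent `P` into a nilpotent part and an
invertible part is Browder: once `T ^ k P = 0`, the kernel and the range of `T ^ k` are those of
`1 - P`, and the ascent and the descent are both the least such `k`. -/
theorem isBrowder_of_idempotent [CompleteSpace X] {T P : X →L[ℂ] X} (hP : P ∈ finiteRankIdeal X)
    (hPP : P * P = P) (hTP : T * P = P * T) {n : ℕ} (hn : T ^ n * P = 0) (hu : IsUnit (T + P)) :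
    IsBrowder T := by
  obtain ⟨u, hu⟩ := hu
  have hcomm : ∀ k, T ^ k * P = P * T ^ k := fun k => (show Commute T P from hTP).pow_left k
  have hucomm : Commute (u : X →L[ℂ] X) (1 - P) := by
    rw [hu]
    refine (Commute.one_right _).sub_right ?_
    exact (show Commute T P from hTP).add_left (Commute.refl P)
  have hpow : ∀ k, T ^ k * (1 - P) = ↑(u ^ k) * (1 - P) := by
    intro k
    induction k with
    | zero => simp
    | succ k ih =>
      have h1 : T * (1 - P) = u * (1 - P) := by
        rw [hu, mul_sub, mul_sub, mul_one, mul_one, add_mul, hPP]; abel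
      calc T ^ (k + 1) * (1 - P) = T ^ k * (u * (1 - P)) := by rw [pow_succ, mul_assoc, h1]
        _ = T ^ k * (1 - P) * u := by rw [hucomm.eq, mul_assoc]
        _ = ↑(u ^ (k + 1)) * (1 - P) := by
          rw [ih, mul_assoc, ← hucomm.eq, ← mul_assoc, pow_succ, Units.val_mul]
  have hTk : ∀ k, T ^ k * P = 0 → T ^ k = ↑(u ^ k) * (1 - P) := fun k hk => by
    rw [← hpow, mul_sub, mul_one, hk, sub_zero]
  have hker : ∀ k, T ^ k * P = 0 → opKer (T ^ k) = opKer (1 - P) := by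
    intro k hk
    ext x
    have h1 : (T ^ k) x = (↑(u ^ k) : X →L[ℂ] X) ((1 - P) x) :=
      DFunLike.congr_fun (hTk k hk) x
    have h2 : (1 - P) x = (↑(u ^ k)⁻¹ : X →L[ℂ] X) ((T ^ k) x) := by
      rw [h1]
      exact (DFunLike.congr_fun (u ^ k).inv_mul ((1 - P) x)).symm
    change (T ^ k) x = 0 ↔ (1 - P) x = 0
    exact ⟨fun h => by rw [h2, h, map_zero], fun h => by rw [h1, h, map_zero]⟩
  have hrange : ∀ k, T ^ k * P = 0 → opRange (T ^ k) = opRange (1 - P) := by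
    intro k hk
    have hc : Commute (↑(u ^ k) : X →L[ℂ] X) (1 - P) := by
      rw [Units.val_pow_eq_pow_val]; exact hucomm.pow_left k
    ext x
    constructor
    · rintro ⟨y, rfl⟩
      exact ⟨(↑(u ^ k) : X →L[ℂ] X) y,
        (DFunLike.congr_fun ((hTk k hk).trans hc.eq) y).symm⟩
    · rintro ⟨y, rfl⟩
      refine ⟨(↑(u ^ k)⁻¹ : X →L[ℂ] X) y, ?_⟩
      have h1 : T ^ k * ↑(u ^ k)⁻¹ = 1 - P := by
        rw [hTk k hk, hc.eq, mul_assoc, Units.mul_inv, mul_one]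
      exact DFunLike.congr_fun h1 y
  have hsucc : ∀ k, T ^ k * P = 0 → T ^ (k + 1) * P = 0 := fun k hk => by
    rw [pow_succ', mul_assoc, hk, mul_zero]
  have hle : ∀ k, n ≤ k → T ^ k * P = 0 := fun k hk => by
    obtain ⟨d, rfl⟩ := Nat.exists_eq_add_of_le hk
    rw [add_comm, pow_add, mul_assoc, hn, mul_zero]
  have hkset : ∀ k, opKer (T ^ k) = opKer (T ^ (k + 1)) ↔ T ^ k * P = 0 := by
    intro k
    constructor
    · intro h
      have h1 : opKer (T ^ k) = opKer (1 - P) := by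
        rw [← opKer_pow_eq_of_le h (le_max_right n k), hker _ (hle _ (le_max_left n k))]
      ext x
      have h2 : P x ∈ opKer (1 - P) := by
        change P x - P (P x) = 0
        rw [sub_eq_zero]
        exact (DFunLike.congr_fun hPP x).symm
      rw [← h1] at h2
      exact h2
    · intro h
      rw [hker k h, hker _ (hsucc k h)]
  have hrset : ∀ k, opRange (T ^ k) = opRange (T ^ (k + 1)) ↔ T ^ k * P = 0 := by
    intro k
    constructor
    · intro h
      have h1 : opRange (T ^ k) = opRange (1 - P) := by
        rw [← opRange_pow_eq_of_le h (le_max_right n k), hrange _ (hle _ (le_max_left n k))]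
      rw [hcomm]
      ext x
      obtain ⟨y, hy⟩ : (T ^ k) x ∈ opRange (1 - P) := h1 ▸ ⟨x, rfl⟩
      have hy' : y - P y = (T ^ k) x := hy
      change P ((T ^ k) x) = 0
      rw [← hy', map_sub, sub_eq_zero]
      exact (DFunLike.congr_fun hPP y).symm
    · intro h
      rw [hrange k h, hrange _ (hsucc k h)]
  refine ⟨(isFredholm_iff_finite T).mpr ⟨?_, ?_⟩, ?_, ascent_lt_top_iff.mpr ⟨n, (hkset n).mpr hn⟩⟩
  · have := finiteDimensional_range_of_mem hP
    refine Submodule.finiteDimensional_of_le (S₂ := opRange P) fun x hx => ?_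
    have hx0 : T x = 0 := hx
    have h1 : x ∈ opKer (T ^ (n + 1)) := by
      change (T ^ (n + 1)) x = 0
      rw [pow_succ]
      change (T ^ n) (T x) = 0
      rw [hx0, map_zero]
    rw [hker _ (hsucc n hn)] at h1
    exact ⟨x, (sub_eq_zero.mp (show x - P x = 0 from h1)).symm⟩
  · have h1 : (opKer P).CoFG := LinearMap.HasFiniteRange.cofg_ker (mem_finiteRankIdeal.mp hP)
    refine Submodule.CoFG.of_le (fun x hx => ?_) h1
    have hx0 : P x = 0 := hx
    have h2 : x ∈ opRange (T ^ (n + 1)) := by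
      rw [hrange _ (hsucc n hn)]
      exact ⟨x, by simp [hx0]⟩
    obtain ⟨y, hy⟩ := h2
    rw [pow_succ'] at hy
    exact ⟨(T ^ n) y, hy⟩
  · simp only [ascent, descent, Set.mem_ofPred_eq, hkset, hrset]

variable [CompleteSpace X]

/-- The Kato decomposition of a left semi-Browder operator. -/
theorem IsLeftSemiBrowder.exists_idempotent {A : X →L[ℂ] X} (h : IsLeftSemiBrowder A) :
    ∃ P ∈ finiteRankIdeal X, P * P = P ∧ A * P = P * A ∧ (∃ n, A ^ n * P = 0) ∧
      ∃ L, L * (A + P) = 1 ∧ L * P = P * L ∧ (1 - (A + P) * L) * P = 0 := by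
  obtain ⟨S, hS⟩ := h.1.exists_one_sub_mul_mem
  obtain ⟨p, hp⟩ := ascent_lt_top_iff.mp h.2
  refine exists_idempotent_nilpotent_leftInverse exists_mul_mul_eq_of_mem_finiteRankIdeal hS
    (p := p) fun U hU => ?_
  ext x
  have h1 : U x ∈ opKer (A ^ (p + 1)) := DFunLike.congr_fun hU x
  rw [← hp] at h1
  exact h1

/-- The Kato decomposition of a right semi-Browder operator. -/
theorem IsRightSemiBrowder.exists_idempotent {B : X →L[ℂ] X} (h : IsRightSemiBrowder B) :
    ∃ Q ∈ finiteRankIdeal X, Q * Q = Q ∧ B * Q = Q * B ∧ (∃ n, B ^ n * Q = 0) ∧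
      ∃ R, (B + Q) * R = 1 ∧ R * Q = Q * R ∧ Q * (1 - R * (B + Q)) = 0 := by
  obtain ⟨S, hS⟩ := h.1.exists_one_sub_mul_mem
  obtain ⟨p, hp⟩ := descent_lt_top_iff.mp h.2
  refine exists_idempotent_nilpotent_rightInverse exists_mul_mul_eq_of_mem_finiteRankIdeal hS
    (p := p) fun U hU => ?_
  ext x
  obtain ⟨y, hy⟩ : (B ^ p) x ∈ opRange (B ^ (p + 1)) := hp ▸ ⟨x, rfl⟩
  change U ((B ^ p) x) = 0
  rw [← hy]
  exact DFunLike.congr_fun hU y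

end Browder

/-! ### Diagonal entries of a Browder operator matrix -/

section DiagonalEntries

variable {X Y : Type*} [NormedAddCommGroup X] [NormedSpace ℂ X]
  [NormedAddCommGroup Y] [NormedSpace ℂ Y] {A : X →L[ℂ] X} {B : Y →L[ℂ] Y} {C : Y →L[ℂ] X}

theorem upperTriangular_pow_inl (k : ℕ) (x : X) :
    (upperTriangular A B C ^ k) (x, 0) = ((A ^ k) x, 0) := by
  induction k with
  | zero => simp
  | succ k ih =>
    rw [pow_succ', pow_succ']
    change upperTriangular A B C ((upperTriangular A B C ^ k) (x, 0)) = _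
    rw [ih]
    simp [upperTriangular]

theorem upperTriangular_pow_snd (k : ℕ) (z : X × Y) :
    ((upperTriangular A B C ^ k) z).2 = (B ^ k) z.2 := by
  induction k with
  | zero => simp
  | succ k ih =>
    rw [pow_succ', pow_succ']
    change B ((upperTriangular A B C ^ k) z).2 = _
    rw [ih]
    rfl

theorem ascent_lt_top_of_upperTriangular (h : ascent (upperTriangular A B C) < ⊤) :
    ascent A < ⊤ := by
  obtain ⟨k, hk⟩ := ascent_lt_top_iff.mp h
  have key : ∀ j x, x ∈ opKer (A ^ j) ↔ (x, 0) ∈ opKer (upperTriangular A B C ^ j) := by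
    intro j x
    change (A ^ j) x = 0 ↔ (upperTriangular A B C ^ j) (x, 0) = 0
    rw [upperTriangular_pow_inl]
    simp
  refine ascent_lt_top_iff.mpr ⟨k, ?_⟩
  ext x
  rw [key, key, hk]

theorem descent_lt_top_of_upperTriangular (h : descent (upperTriangular A B C) < ⊤) :
    descent B < ⊤ := by
  obtain ⟨k, hk⟩ := descent_lt_top_iff.mp h
  have key : ∀ j, opRange (B ^ j) =
      (opRange (upperTriangular A B C ^ j)).map (LinearMap.snd ℂ X Y) := by
    intro j
    ext y
    constructor
    · rintro ⟨w, rfl⟩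
      exact ⟨_, ⟨(0, w), rfl⟩, upperTriangular_pow_snd j (0, w)⟩
    · rintro ⟨_, ⟨z, rfl⟩, rfl⟩
      exact ⟨z.2, (upperTriangular_pow_snd j z).symm⟩
  exact descent_lt_top_iff.mpr ⟨k, by rw [key, key, hk]⟩

theorem IsBrowder.hasIndex_zero {T : X →L[ℂ] X} (h : IsBrowder T) :
    (T : X →ₗ[ℂ] X).HasIndex 0 := by
  obtain ⟨k, hk⟩ := ascent_lt_top_iff.mp h.2.2
  obtain ⟨m, hm⟩ := descent_lt_top_iff.mp (h.2.1 ▸ h.2.2)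
  have hT : (T : X →ₗ[ℂ] X).HasIndex (T : X →ₗ[ℂ] X).index :=
    ⟨h.1.finite_ker, h.1.finite_coker, rfl⟩
  have h0 := hT.eq_zero_of_pow (k := max k m)
    (by
      rw [← ContinuousLinearMap.toLinearMap_pow, ← ContinuousLinearMap.toLinearMap_pow]
      exact (opKer_pow_eq_of_le hk (le_max_left k m)).trans
        (opKer_pow_eq_of_le hk ((le_max_left k m).trans (Nat.le_succ _))).symm)
    (by
      rw [← ContinuousLinearMap.toLinearMap_pow, ← ContinuousLinearMap.toLinearMap_pow]
      exact (opRange_pow_eq_of_le hm (le_max_right k m)).trans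
        (opRange_pow_eq_of_le hm ((le_max_right k m).trans (Nat.le_succ _))).symm)
  rwa [h0] at hT

theorem IsBrowder.isLeftSemiBrowder_isRightSemiBrowder
    (h : IsBrowder (upperTriangular A B C)) : IsLeftSemiBrowder A ∧ IsRightSemiBrowder B := by
  obtain ⟨V, hVl, hVr⟩ := h.1.exists_isQuasiInverse
  have hl := LinearMap.FiniteRangeSetoid.equiv_iff_hasFiniteRange.mp hVl
  have hr := LinearMap.FiniteRangeSetoid.equiv_iff_hasFiniteRange.mp hVr
  -- The diagonal corners of a quasi-inverse of `M_C` are one-sided quasi-inverses of `A` and `B`.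
  have hA : 1 - ((ContinuousLinearMap.fst ℂ X Y).comp
      (V.comp (ContinuousLinearMap.inl ℂ X Y))) * A ∈ finiteRankIdeal X := by
    rw [mem_finiteRankIdeal]
    refine Eq.subst (motive := LinearMap.HasFiniteRange) (LinearMap.ext fun x => ?_)
      ((hl.comp_left (LinearMap.fst ℂ X Y)).comp_right (LinearMap.inl ℂ X Y)).neg
    simp [upperTriangular]
  have hB : 1 - B * ((ContinuousLinearMap.snd ℂ X Y).comp
      (V.comp (ContinuousLinearMap.inr ℂ X Y))) ∈ finiteRankIdeal Y := by
    rw [mem_finiteRankIdeal]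
    refine Eq.subst (motive := LinearMap.HasFiniteRange) (LinearMap.ext fun y => ?_)
      ((hr.comp_left (LinearMap.snd ℂ X Y)).comp_right (LinearMap.inr ℂ X Y)).neg
    simp [upperTriangular]
  exact ⟨⟨isLeftSemiFredholm_of_one_sub_mul_mem hA, ascent_lt_top_of_upperTriangular h.2.2⟩,
    ⟨isRightSemiFredholm_of_one_sub_mul_mem hB,
      descent_lt_top_of_upperTriangular (h.2.1 ▸ h.2.2)⟩⟩

variable [CompleteSpace X] [CompleteSpace Y]

/-- If `M_C` is Browder, the map `N(A) × N(B) → X/R(A) × Y/R(B)`, `(a, b) ↦ ([C b], 0)`, has the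
index of `M_C`, which is zero. -/
theorem IsBrowder.nonempty_ker_prod_equiv_coker_prod (h : IsBrowder (upperTriangular A B C)) :
    Nonempty ((opKer A × opKer B) ≃L[ℂ] ((X ⧸ opRange A) × (Y ⧸ opRange B))) := by
  obtain ⟨hA, hB⟩ := h.isLeftSemiBrowder_isRightSemiBrowder
  have : IsClosed (opRange A : Set X) := hA.1.1
  have : IsClosed (opRange B : Set Y) := hB.1.isClosed_opRange
  have : FiniteDimensional ℂ (opKer A) := hA.1.2.2
  have : FiniteDimensional ℂ (Y ⧸ opRange B) := hB.1.2.2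
  have : CompleteSpace (opKer A) := A.isClosed_ker.completeSpace_coe
  have : CompleteSpace (opKer B) := B.isClosed_ker.completeSpace_coe
  have hδ := LinearMap.HasIndex.connecting (A := (A : X →ₗ[ℂ] X)) (B := (B : Y →ₗ[ℂ] Y))
    (C := (C : Y →ₗ[ℂ] X)) (fun x y => rfl) h.hasIndex_zero
  let Φ : (opKer A × opKer B) →L[ℂ] ((X ⧸ opRange A) × (Y ⧸ opRange B)) :=
    (ContinuousLinearMap.inl ℂ (X ⧸ opRange A) (Y ⧸ opRange B)).comp
      (((opRange A).mkQL.comp (C.comp (opKer B).subtypeL)).comp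
        (ContinuousLinearMap.snd ℂ (opKer A) (opKer B)))
  have hΦ : (Φ : (opKer A × opKer B) →ₗ[ℂ] ((X ⧸ opRange A) × (Y ⧸ opRange B))).HasIndex 0 := by
    have h1 := (LinearMap.HasIndex.inl (K := ℂ) (V := X ⧸ opRange A) (W := Y ⧸ opRange B)).comp
      (hδ.comp (LinearMap.HasIndex.snd (K := ℂ) (V := opKer A) (W := opKer B)))
    have h2 : -(Module.finrank ℂ (Y ⧸ opRange B) : ℤ) +
        (0 - Module.finrank ℂ (opKer A) + Module.finrank ℂ (Y ⧸ opRange B) +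
          Module.finrank ℂ (opKer A)) = 0 := by ring
    rw [h2] at h1
    exact h1
  exact hΦ.nonempty_continuousLinearEquiv

end DiagonalEntries

/-! ### Completion to a Browder operator matrix -/

section Completion

variable {X Y : Type*} [NormedAddCommGroup X] [NormedSpace ℂ X]
  [NormedAddCommGroup Y] [NormedSpace ℂ Y]

theorem hasIndex_one_sub {F : X →L[ℂ] X} (hF : F ∈ finiteRankIdeal X) :
    ((1 - F : X →L[ℂ] X) : X →ₗ[ℂ] X).HasIndex 0 :=
  have := finiteDimensional_range_of_mem hF
  LinearMap.HasIndex.id_sub (F : X →ₗ[ℂ] X)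

theorem prodMap_mem_finiteRankIdeal {P : X →L[ℂ] X} {Q : Y →L[ℂ] Y} (hP : P ∈ finiteRankIdeal X)
    (hQ : Q ∈ finiteRankIdeal Y) : P.prodMap Q ∈ finiteRankIdeal (X × Y) := by
  rw [mem_finiteRankIdeal] at hP hQ ⊢
  refine Eq.subst (motive := LinearMap.HasFiniteRange) (LinearMap.ext fun z => ?_)
    (((hP.comp_left (LinearMap.inl ℂ X Y)).comp_right (LinearMap.fst ℂ X Y)).add
      ((hQ.comp_left (LinearMap.inr ℂ X Y)).comp_right (LinearMap.snd ℂ X Y)))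
  simp

variable [CompleteSpace X] [CompleteSpace Y]

/-- Passing to the finite-rank perturbations `A' = A + P` and `B' = B + Q`, which are left, respectively
right, invertible cancels the finite-dimensional factors of
`N(A) × N(B) ≃ X/R(A) × Y/R(B)` and leaves `N(B') ≃ X/R(A')`. Here `X/R(A')` is represented by the
complement `N(L)` of `R(A')`. -/
theorem nonempty_ker_equiv_ker {A P L : X →L[ℂ] X} {B Q R : Y →L[ℂ] Y}
    (hP : P ∈ finiteRankIdeal X) (hL : L * (A + P) = 1) (hLP : (1 - (A + P) * L) * P = 0)
    (hQ : Q ∈ finiteRankIdeal Y) (hR : (B + Q) * R = 1) (hRQ : Q * (1 - R * (B + Q)) = 0)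
    [FiniteDimensional ℂ (opKer A)] [FiniteDimensional ℂ (Y ⧸ opRange B)]
    (e : (opKer A × opKer B) ≃L[ℂ] ((X ⧸ opRange A) × (Y ⧸ opRange B))) :
    Nonempty (opKer (B + Q) ≃L[ℂ] opKer L) := by
  have hA : (A + P) * (L * A) = A := by
    have h1 : A - (A + P) * (L * A) =
        (A + P) - (A + P) * (L * (A + P)) - (1 - (A + P) * L) * P := by noncomm_ring
    rw [hL, hLP, mul_one, sub_self, sub_zero] at h1
    exact (sub_eq_zero.mp h1).symm
  have hB : B * (R * (B + Q)) = B := by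
    have h1 : B - B * (R * (B + Q)) =
        (B + Q) - (B + Q) * R * (B + Q) - Q * (1 - R * (B + Q)) := by noncomm_ring
    rw [hR, hRQ, one_mul, sub_self, sub_zero] at h1
    exact (sub_eq_zero.mp h1).symm
  have hLA : L * A = 1 - L * P := by rw [← hL]; noncomm_ring
  have hBR : B * R = 1 - Q * R := by rw [← hR]; noncomm_ring
  have hLA0 := hasIndex_one_sub ((finiteRankIdeal X).mul_mem_left L P hP)
  have hBR0 := hasIndex_one_sub ((finiteRankIdeal Y).mul_mem_right Q R hQ)
  rw [← hLA] at hLA0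
  rw [← hBR] at hBR0
  have hleA : opRange A ≤ opRange (A + P) := by
    rintro _ ⟨x, rfl⟩
    exact ⟨L (A x), DFunLike.congr_fun hA x⟩
  have hleB : opKer (B + Q) ≤ opKer B := by
    intro y hy
    have h1 : (B + Q) y = 0 := hy
    have h2 : B (R ((B + Q) y)) = B y := DFunLike.congr_fun hB y
    rw [h1, map_zero, map_zero] at h2
    exact h2.symm
  have hq := LinearMap.HasIndex.factor (A := (A : X →ₗ[ℂ] X))
    (A' := ((A + P : X →L[ℂ] X) : X →ₗ[ℂ] X)) (L := (L : X →ₗ[ℂ] X))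
    (congrArg ContinuousLinearMap.toLinearMap hL)
    (congrArg ContinuousLinearMap.toLinearMap hA) hLA0 hleA
  have hi := LinearMap.HasIndex.inclusion (B := (B : Y →ₗ[ℂ] Y))
    (B' := ((B + Q : Y →L[ℂ] Y) : Y →ₗ[ℂ] Y))
    (R := (R : Y →ₗ[ℂ] Y)) (congrArg ContinuousLinearMap.toLinearMap hR)
    (congrArg ContinuousLinearMap.toLinearMap hB) hBR0 hleB
  have hcompl : Submodule.IsTopCompl (opRange (A + P)) (opKer L) :=
    ContinuousLinearMap.isTopCompl_range_ker_of_leftInverse (A + P) L (DFunLike.congr_fun hL)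
  have : IsClosed (opRange (A + P) : Set X) := hcompl.isClosed
  have : CompleteSpace (opKer (B + Q)) := (B + Q).isClosed_ker.completeSpace_coe
  have hT := hq.comp ((LinearMap.HasIndex.fst (K := ℂ) (V := X ⧸ opRange A)
    (W := Y ⧸ opRange B)).comp ((LinearMap.HasIndex.of_equiv e.toLinearEquiv).comp
      ((LinearMap.HasIndex.inr (K := ℂ) (V := opKer A) (W := opKer B)).comp hi)))
  have h0 : (Module.finrank ℂ (opKer A) : ℤ) + (Module.finrank ℂ (Y ⧸ opRange B) +
      (0 + (-Module.finrank ℂ (opKer A) + -Module.finrank ℂ (Y ⧸ opRange B)))) = 0 := by ring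
  rw [h0] at hT
  have hcont : Continuous (Submodule.factor hleA) :=
    (opRange A).isQuotientMap_mkQL.continuous_iff.mpr (opRange (A + P)).mkQL.continuous
  let T : opKer (B + Q) →L[ℂ] X ⧸ opRange (A + P) :=
    ⟨Submodule.factor hleA ∘ₗ LinearMap.fst ℂ (X ⧸ opRange A) (Y ⧸ opRange B) ∘ₗ
      (e.toLinearEquiv : _ →ₗ[ℂ] _) ∘ₗ LinearMap.inr ℂ (opKer A) (opKer B) ∘ₗ
        Submodule.inclusion hleB, hcont.comp (continuous_fst.comp (e.continuous.comp
      ((ContinuousLinearMap.inr ℂ (opKer A) (opKer B)).continuous.comp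
        (continuous_inclusion hleB))))⟩
  obtain ⟨j⟩ := LinearMap.HasIndex.nonempty_continuousLinearEquiv (T := T) hT
  exact ⟨j.trans (Submodule.quotientEquivOfIsTopCompl _ _ hcompl)⟩

/-- Let `P` and `Q` be the idempotents that split off the nilpotent parts of `A` and `B`. If `C` maps
the kernel of `B + Q` isomorphically onto a complement of the range of `A + P`, and vanishes on a
complement of that kernel, then `M_C + diag(P, Q)` is invertible and `diag(P, Q)` commutes with
`M_C`. -/
theorem exists_isBrowder_upperTriangular {A : X →L[ℂ] X} {B : Y →L[ℂ] Y}
    (hA : IsLeftSemiBrowder A) (hB : IsRightSemiBrowder B)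
    (e : (opKer A × opKer B) ≃L[ℂ] ((X ⧸ opRange A) × (Y ⧸ opRange B))) :
    ∃ C : Y →L[ℂ] X, IsBrowder (upperTriangular A B C) := by
  obtain ⟨P, hP, hPP, hAP, ⟨m, hm⟩, L, hL, hLP, hLP'⟩ := hA.exists_idempotent
  obtain ⟨Q, hQ, hQQ, hBQ, ⟨n, hn⟩, R, hR, hRQ, hRQ'⟩ := hB.exists_idempotent
  have : FiniteDimensional ℂ (opKer A) := hA.1.2.2
  have : FiniteDimensional ℂ (Y ⧸ opRange B) := hB.1.2.2
  obtain ⟨j⟩ := nonempty_ker_equiv_ker hP hL hLP' hQ hR hRQ' e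
  have hLapp : ∀ x, L (A x + P x) = x := DFunLike.congr_fun hL
  have hRapp : ∀ y, B (R y) + Q (R y) = y := DFunLike.congr_fun hR
  -- `C` is `j` on the kernel of `B + Q`, extended by zero on the range of `R`; `D` is the inverse
  -- of `j`, extended by zero on the range of `A + P`.
  let πH : Y →L[ℂ] opKer (B + Q) := (1 - R * (B + Q)).codRestrict _ fun y => by
    change B (y - R (B y + Q y)) + Q (y - R (B y + Q y)) = 0
    have h1 := hRapp (B y + Q y)
    rw [map_sub, map_sub, sub_add_sub_comm, h1, sub_self]
  let πG : X →L[ℂ] opKer L := (1 - (A + P) * L).codRestrict _ fun x => by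
    change L (x - (A (L x) + P (L x))) = 0
    rw [map_sub, hLapp, sub_self]
  have hπH : ∀ y, (πH y : Y) = y - R (B y + Q y) := fun y => rfl
  have hπG : ∀ x, (πG x : X) = x - (A (L x) + P (L x)) := fun x => rfl
  have hπH_id : ∀ y : opKer (B + Q), πH y = y := fun y => Subtype.ext (by
    have h1 : B y + Q y = 0 := y.2
    rw [hπH, h1, map_zero, sub_zero])
  have hπG_id : ∀ x : opKer L, πG x = x := fun x => Subtype.ext (by
    have h1 : L x = 0 := x.2
    rw [hπG, h1, map_zero, map_zero, add_zero, sub_zero])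
  let C : Y →L[ℂ] X := (opKer L).subtypeL.comp ((j : opKer (B + Q) →L[ℂ] opKer L).comp πH)
  let D : X →L[ℂ] Y :=
    (opKer (B + Q)).subtypeL.comp ((j.symm : opKer L →L[ℂ] opKer (B + Q)).comp πG)
  have hC : ∀ y, C y = j (πH y) := fun y => rfl
  have hD : ∀ x, D x = j.symm (πG x) := fun x => rfl
  have hLC : ∀ y, L (C y) = 0 := fun y => (j (πH y)).2
  have hBD : ∀ x, B (D x) + Q (D x) = 0 := fun x => (j.symm (πG x)).2
  have hCR : ∀ y, C (R y) = 0 := fun y => by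
    have h1 : πH (R y) = 0 := Subtype.ext (by rw [hπH, hRapp, sub_self]; rfl)
    rw [hC, h1, map_zero]
    rfl
  have hDA : ∀ x, D (A x + P x) = 0 := fun x => by
    have h1 : πG (A x + P x) = 0 := Subtype.ext (by rw [hπG, hLapp, sub_self]; rfl)
    rw [hD, h1, map_zero]
    rfl
  have hCD : ∀ x, C (D x) = x - (A (L x) + P (L x)) := fun x => by
    rw [hC, hD, hπH_id, j.apply_symm_apply, hπG]
  have hDC : ∀ y, D (C y) = y - R (B y + Q y) := fun y => by
    rw [hC, hD, hπG_id, j.symm_apply_apply, hπH]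
  have hAPx : ∀ x, A (P x) = P (A x) := DFunLike.congr_fun hAP
  have hBQx : ∀ y, B (Q y) = Q (B y) := DFunLike.congr_fun hBQ
  have hLPx : ∀ x, L (P x) = P (L x) := DFunLike.congr_fun hLP
  have hRQx : ∀ y, R (Q y) = Q (R y) := DFunLike.congr_fun hRQ
  have hPC : ∀ y, P (C y) = 0 := fun y => by
    have h1 : P (C y) - (A (L (P (C y))) + P (L (P (C y)))) = 0 := DFunLike.congr_fun hLP' (C y)
    rw [hLPx, hLC] at h1
    simpa using h1
  have hCQ : ∀ y, C (Q y) = 0 := fun y => by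
    have h1 : Q (y - R (B y + Q y)) = 0 := DFunLike.congr_fun hRQ' y
    have h2 : πH (Q y) = 0 := Subtype.ext (by
      rw [hπH, hBQx, ← map_add, hRQx, ← map_sub, h1]; rfl)
    rw [hC, h2, map_zero]
    rfl
  let N : (X × Y) →L[ℂ] (X × Y) := (L.comp (ContinuousLinearMap.fst ℂ X Y)).prod (D.coprod R)
  have hPQ : ∀ z : X × Y, (P.prodMap Q) z = (P z.1, Q z.2) := fun z => rfl
  have hM : ∀ z : X × Y, upperTriangular A B C z = (A z.1 + C z.2, B z.2) := fun z => rfl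
  have hN : ∀ z : X × Y, N z = (L z.1, D z.1 + R z.2) := fun z => rfl
  have hpow : ∀ k (z : X × Y), (upperTriangular A B C ^ k) (P z.1, Q z.2) =
      ((A ^ k) (P z.1), (B ^ k) (Q z.2)) := by
    intro k z
    induction k with
    | zero => rfl
    | succ k ih =>
      have h1 : (B ^ k) (Q z.2) = Q ((B ^ k) z.2) :=
        DFunLike.congr_fun ((show Commute B Q from hBQ).pow_left k).eq z.2
      rw [pow_succ', pow_succ', pow_succ']
      change upperTriangular A B C ((upperTriangular A B C ^ k) (P z.1, Q z.2)) = _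
      rw [ih, hM]
      refine Prod.ext ?_ rfl
      change A ((A ^ k) (P z.1)) + C ((B ^ k) (Q z.2)) = A ((A ^ k) (P z.1))
      rw [h1, hCQ, add_zero]
  refine ⟨C, isBrowder_of_idempotent (P := P.prodMap Q) (n := m + n)
    (prodMap_mem_finiteRankIdeal hP hQ) ?_ ?_ ?_ ⟨⟨upperTriangular A B C + P.prodMap Q, N, ?_, ?_⟩,
      rfl⟩⟩
  · exact ContinuousLinearMap.ext fun z =>
      Prod.ext (DFunLike.congr_fun hPP z.1) (DFunLike.congr_fun hQQ z.2)
  · refine ContinuousLinearMap.ext fun z => Prod.ext ?_ ?_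
    · change A (P z.1) + C (Q z.2) = P (A z.1 + C z.2)
      rw [hCQ, map_add, hPC, hAPx]
    · exact hBQx z.2
  · have h1 : A ^ (m + n) * P = 0 := by rw [add_comm, pow_add, mul_assoc, hm, mul_zero]
    have h2 : B ^ (m + n) * Q = 0 := by rw [pow_add, mul_assoc, hn, mul_zero]
    refine ContinuousLinearMap.ext fun z => (hpow (m + n) z).trans ?_
    exact Prod.ext (DFunLike.congr_fun h1 z.1) (DFunLike.congr_fun h2 z.2)
  · refine ContinuousLinearMap.ext fun z => ?_
    change upperTriangular A B C (N z) + (P.prodMap Q) (N z) = z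
    rw [hM, hPQ, hN]
    refine Prod.ext ?_ ?_
    · change A (L z.1) + C (D z.1 + R z.2) + P (L z.1) = z.1
      rw [map_add C, hCR, hCD]
      abel
    · change B (D z.1 + R z.2) + Q (D z.1 + R z.2) = z.2
      rw [map_add, map_add, add_add_add_comm, hBD, hRapp, zero_add]
  · refine ContinuousLinearMap.ext fun z => ?_
    change N (upperTriangular A B C z + (P.prodMap Q) z) = z
    rw [hM, hPQ, hN]
    refine Prod.ext ?_ ?_
    · change L (A z.1 + C z.2 + P z.1) = z.1
      rw [add_right_comm, map_add, hLapp, hLC, add_zero]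
    · change D (A z.1 + C z.2 + P z.1) + R (B z.2 + Q z.2) = z.2
      rw [add_right_comm, map_add D, hDA, hDC]
      abel

end Completion

/-! ### The spectrum -/

theorem upperTriangular_opShift {X Y : Type*} [NormedAddCommGroup X] [NormedSpace ℂ X]
    [NormedAddCommGroup Y] [NormedSpace ℂ Y] (A : X →L[ℂ] X) (B : Y →L[ℂ] Y) (C : Y →L[ℂ] X)
    (z : ℂ) :
    upperTriangular (opShift A z) (opShift B z) C = opShift (upperTriangular A B C) z := by
  refine ContinuousLinearMap.ext fun w => Prod.ext ?_ rfl
  change A w.1 - z • w.1 + C w.2 = A w.1 + C w.2 - z • w.1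
  abel

theorem corollary2p10 {X Y : Type*} [NormedAddCommGroup X] [NormedSpace ℂ X] [CompleteSpace X]
    [NormedAddCommGroup Y] [NormedSpace ℂ Y] [CompleteSpace Y]
    (A : X →L[ℂ] X) (B : Y →L[ℂ] Y) :
    (⋂ C : Y →L[ℂ] X, browderSpectrum (upperTriangular A B C)) =
      leftBrowderSpectrum A ∪ rightBrowderSpectrum B ∪
        {z : ℂ | ¬ Nonempty
          ((opKer (opShift A z) × opKer (opShift B z)) ≃L[ℂ]
            ((X ⧸ opRange (opShift A z)) × (Y ⧸ opRange (opShift B z))))} := by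
  ext z
  rw [← not_iff_not]
  simp only [browderSpectrum, leftBrowderSpectrum, rightBrowderSpectrum, Set.mem_iInter,
    Set.mem_union, Set.mem_ofPred_eq, not_forall, not_or, not_not, ← upperTriangular_opShift]
  constructor
  · rintro ⟨C, hC⟩
    exact ⟨hC.isLeftSemiBrowder_isRightSemiBrowder, hC.nonempty_ker_prod_equiv_coker_prod⟩
  · rintro ⟨⟨hA, hB⟩, ⟨e⟩⟩
    exact exists_isBrowder_upperTriangular hA hB e
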